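/- Let $\mathbb{P}$ be the set of positive integers with its usual order, and let $\mathbb{P}^*$ be the set of finite words over $\mathbb{P}$. For $u, w \in \mathbb{P}^*$, say that $w$ embeds $u$, written $u \le w$, if there is a string $v$ of $|u|$ consecutive letters of $w$ such that, for each $i$, the $i$-th letter of $v$ is greater than or equal to the $i$-th letter of $u$. Let the weight of a word $w = w_1 \cdots w_n$ be $\mathrm{wt}(w) = t^n x^{w_1 + \cdots + w_n}$, and let $F(u;t,x) = \sum_{w \in \mathbb{P}^*,\, u \le w} \mathrm{wt}(w)$, a formal power series in $t$ and $x$. Words $u, v \in \mathbb{P}^*$ are Wilf equivalent if $F(u;t,x) = F(v;t,x)$. Theorem. Wilf equivalence partitions the set $\mathbb{P}^3$ of words of length 3 into exactly the following equivalence classes, where $a, b, c$ range over the positive integers: 1. $\{aaa\}$, for every $a$; 2. $\{aab, aba, baa\}$, for all $a < b$; 3. $\{aab, baa\}$ and $\{aba\}$ (two different classes), for all $a > b$; 4. $\{bac, cab\}$ and $\{abc, acb, cba, bca\}$ (two different classes), for all $a < b < c$. -/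

import Mathlib

/-- Generalized factor order on words over a set `P` with an order relation: `u` is below `w` if
some string `v` of `|u|` consecutive characters of `w` dominates `u` letter by letter. -/
def GenFactorLE {P : Type*} [LE P] (u w : List P) : Prop :=
  ∃ v : List P, v <:+: w ∧ List.Forall₂ (fun a b => a ≤ b) u v

/-- The sum of the letters of a word over the positive integers. -/
def letterSum (w : List ℕ+) : ℕ :=
  (List.map (fun a : ℕ+ => (a : ℕ)) w).sum

/-- The weight `t ^ |w| * x ^ Σ(w)`, as a formal power series in `t = X 0` and `x = X 1`. -/
noncomputable def wt (w : List ℕ+) : MvPowerSeries (Fin 2) ℤ :=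
  MvPowerSeries.X 0 ^ w.length * MvPowerSeries.X 1 ^ letterSum w

/-- The set of words over the positive integers that embed `u`. -/
def embeddingWords (u : List ℕ+) : Set (List ℕ+) :=
  {w | GenFactorLE u w}

theorem wt_eq_monomial (w : List ℕ+) :
    wt w = MvPowerSeries.monomial
      (Finsupp.single 0 w.length + Finsupp.single 1 (letterSum w)) (1 : ℤ) := by
  rw [wt, MvPowerSeries.X_pow_eq, MvPowerSeries.X_pow_eq, MvPowerSeries.monomial_mul_monomial,
    one_mul]

theorem le_letterSum {w : List ℕ+} {a : ℕ+} (ha : a ∈ w) : (a : ℕ) ≤ letterSum w := by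
  have h : (fun a : ℕ+ => (a : ℕ)) a ∈ List.map (fun a : ℕ+ => (a : ℕ)) w :=
    List.mem_map_of_mem ha
  exact List.single_le_sum (fun _ _ => Nat.zero_le _) _ h

/-- Only finitely many words contribute to each coefficient, so that the formal sum of the weights
of any set of words makes sense. -/
theorem finite_coeff_wt_ne_zero (m : Fin 2 →₀ ℕ) :
    {w : List ℕ+ | MvPowerSeries.coeff m (wt w) ≠ 0}.Finite := by
  classical
  refine ((List.finite_length_eq (Fin (m 1)) (m 0)).image
    (List.map fun i : Fin (m 1) => Nat.succPNat (i : ℕ))).subset ?_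
  intro w hw
  have hm : m = Finsupp.single 0 w.length + Finsupp.single 1 (letterSum w) := by
    by_contra h
    exact hw (by rw [wt_eq_monomial, MvPowerSeries.coeff_monomial, if_neg h])
  have h0 : m 0 = w.length := by simp [hm]
  have h1 : m 1 = letterSum w := by simp [hm]
  have hlt : ∀ a ∈ w, (a : ℕ) - 1 < m 1 := fun a ha => by
    have h2 := le_letterSum ha
    have h3 := a.pos
    omega
  refine ⟨w.pmap (fun (a : ℕ+) h => ⟨(a : ℕ) - 1, h⟩) hlt, by simp [h0], ?_⟩
  rw [List.map_pmap]
  conv_rhs => rw [← List.map_id w, ← List.pmap_eq_map (p := fun a : ℕ+ => (a : ℕ) - 1 < m 1) hlt]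
  refine List.pmap_congr_left w fun a _ _ _ => ?_
  apply PNat.eq
  have := a.pos
  simp only [Nat.succPNat_coe, id]
  omega

/-- The generating function `F(u; t, x)`: the formal sum of `wt w` over all words `w` that
embed `u`, taken coefficient by coefficient. -/
noncomputable def embeddingGenFun (u : List ℕ+) : MvPowerSeries (Fin 2) ℤ :=
  fun m => ∑ᶠ w ∈ embeddingWords u, MvPowerSeries.coeff m (wt w)

/-- Wilf equivalence of words over the positive integers: `F(u; t, x) = F(v; t, x)`. -/
noncomputable def wilfEquiv : Setoid (List ℕ+) :=
  Setoid.ker embeddingGenFun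

/-- Wilf equivalence on the words of length `3`. -/
noncomputable def wilfEquivThree : Setoid (List.Vector ℕ+ 3) :=
  Setoid.comap List.Vector.toList wilfEquiv

/-- The word `a b c` of length `3`. -/
def wordThree (a b c : ℕ+) : List.Vector ℕ+ 3 :=
  ⟨[a, b, c], rfl⟩

/-! Two moves generate all the equivalences: reversing words, and exchanging `x` and `y` in `p x y`
when `p ≤ x, y`. For the second, cut a word into maximal blocks of letters `≥ p`. An occurrence of
`p x y` lies within one block, where the condition on `p` only asks for some preceding letter, so
reversing each block after its first letter turns it into an occurrence of `p y x`
(`genFactorLE_reverseBlocks`).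

For separation, shift letters to start at 0. Inclusion-exclusion over the windows in words of length
3, 4 and 5 recovers from `F` the sum `S`, the maximum `M`, `T = a + max a b + max b c + c` and `U =
b + max a c` (`overlap_sums_of_embeddingGenFun_eq`). Then `S - U = min a c`, so the letters are `S -
U`, `M` and the remainder; given the letters, `T` tells whether a unique smallest letter is in the
middle, which is all that the two moves preserve. -/

/-! ### Recursive form of the embedding order, and reversal. -/

section Embedding

variable {P : Type*} [LE P]

/-- `u` is dominated letter by letter by a prefix of `w`. -/
def PrefixLE (u w : List P) : Prop :=
  ∃ v : List P, v <+: w ∧ List.Forall₂ (fun a b => a ≤ b) u v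

theorem prefixLE_nil (w : List P) : PrefixLE [] w :=
  ⟨[], List.nil_prefix, List.Forall₂.nil⟩

theorem not_prefixLE_cons_nil (a : P) (u : List P) : ¬ PrefixLE (a :: u) [] := by
  rintro ⟨v, hv, h⟩
  rw [List.prefix_nil.1 hv] at h
  cases h

theorem prefixLE_cons_cons (a x : P) (u w : List P) :
    PrefixLE (a :: u) (x :: w) ↔ a ≤ x ∧ PrefixLE u w := by
  constructor
  · rintro ⟨v, hv, h⟩
    cases h with
    | cons h1 h2 =>
      rw [List.cons_prefix_cons] at hv
      exact ⟨hv.1 ▸ h1, _, hv.2, h2⟩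
  · rintro ⟨h1, v, hv, h2⟩
    exact ⟨x :: v, List.cons_prefix_cons.2 ⟨rfl, hv⟩, List.Forall₂.cons h1 h2⟩

theorem not_genFactorLE_cons_nil (a : P) (u : List P) : ¬ GenFactorLE (a :: u) [] := by
  rintro ⟨v, hv, h⟩
  rw [List.infix_nil.1 hv] at h
  cases h

theorem genFactorLE_cons (u : List P) (x : P) (w : List P) :
    GenFactorLE u (x :: w) ↔ PrefixLE u (x :: w) ∨ GenFactorLE u w := by
  simp only [GenFactorLE, PrefixLE, List.infix_cons_iff, or_and_right, exists_or]

theorem GenFactorLE.reverse {u w : List P} (h : GenFactorLE u w) :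
    GenFactorLE u.reverse w.reverse := by
  obtain ⟨v, hv, h⟩ := h
  exact ⟨v.reverse, List.reverse_infix.2 hv, List.forall₂_reverse_iff.2 h⟩

theorem genFactorLE_reverse_iff {u w : List P} :
    GenFactorLE u.reverse w.reverse ↔ GenFactorLE u w :=
  ⟨fun h => by simpa using h.reverse, GenFactorLE.reverse⟩

end Embedding

/-! ### The block-reversing involution. -/

section BlockReversal

/-- Cut a word into maximal blocks of letters at least `p`, and reverse each block
apart from its first letter. -/
def reverseBlocks (p : ℕ+) : List ℕ+ → List ℕ+
  | [] => []
  | a :: w =>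
    if a < p then a :: reverseBlocks p w
    else a :: ((w.takeWhile (p ≤ ·)).reverse ++ reverseBlocks p (w.dropWhile (p ≤ ·)))
termination_by w => w.length
decreasing_by
  · simp
  · simpa using Nat.lt_succ_of_le (List.length_dropWhile_le _ w)

theorem reverseBlocks_nil (p : ℕ+) : reverseBlocks p [] = [] := by
  rw [reverseBlocks]

theorem reverseBlocks_cons_of_lt {p a : ℕ+} (h : a < p) (w : List ℕ+) :
    reverseBlocks p (a :: w) = a :: reverseBlocks p w := by
  rw [reverseBlocks, if_pos h]

theorem takeWhile_append_of_head_lt {p : ℕ+} {f g : List ℕ+} (hf : ∀ x ∈ f, p ≤ x)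
    (hg : ∀ x ∈ g.head?, x < p) :
    (f ++ g).takeWhile (p ≤ ·) = f ∧ (f ++ g).dropWhile (p ≤ ·) = g := by
  rw [List.takeWhile_append_of_pos (by simpa using hf),
    List.dropWhile_append_of_pos (by simpa using hf)]
  cases g with
  | nil => simp
  | cons b g =>
    have hb : ¬ p ≤ b := not_le.2 (hg b (by simp))
    simp [hb]

theorem reverseBlocks_block {p a : ℕ+} (h : p ≤ a) {f g : List ℕ+} (hf : ∀ x ∈ f, p ≤ x)
    (hg : ∀ x ∈ g.head?, x < p) :
    reverseBlocks p (a :: (f ++ g)) = a :: (f.reverse ++ reverseBlocks p g) := by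
  obtain ⟨h1, h2⟩ := takeWhile_append_of_head_lt hf hg
  rw [reverseBlocks, if_neg (not_lt.2 h), h1, h2]

/-- Induction along the decomposition of a word into maximal blocks of letters at least `p`. -/
theorem block_induction (p : ℕ+) {motive : List ℕ+ → Prop} (nil : motive [])
    (low : ∀ a w, a < p → motive w → motive (a :: w))
    (block : ∀ a f g, p ≤ a → (∀ x ∈ f, p ≤ x) → (∀ x ∈ g.head?, x < p) → motive g →
      motive (a :: (f ++ g))) (w : List ℕ+) : motive w := by
  induction hn : w.length using Nat.strong_induction_on generalizing w with
  | _ n ih =>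
    subst hn
    cases w with
    | nil => exact nil
    | cons a w =>
      rcases lt_or_ge a p with h | h
      · exact low a w h (ih _ (by simp) w rfl)
      · rw [← List.takeWhile_append_dropWhile (p := fun x => decide (p ≤ x)) (l := w)]
        refine block a _ _ h ?_ ?_ (ih _ ?_ _ rfl)
        · intro x hx
          simpa using List.mem_takeWhile_imp hx
        · intro x hx
          have := List.head?_dropWhile_not (fun x => decide (p ≤ x)) w
          rw [Option.mem_def.1 hx] at this
          simpa using this
        · simpa using Nat.lt_succ_of_le (List.length_dropWhile_le _ w)

theorem head?_reverseBlocks (p : ℕ+) (w : List ℕ+) : (reverseBlocks p w).head? = w.head? := by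
  cases w with
  | nil => rw [reverseBlocks_nil]
  | cons a w =>
    rw [reverseBlocks]
    split_ifs <;> rfl

theorem reverseBlocks_reverseBlocks (p : ℕ+) (w : List ℕ+) :
    reverseBlocks p (reverseBlocks p w) = w := by
  induction w using block_induction p with
  | nil => simp only [reverseBlocks_nil]
  | low a w h ih => rw [reverseBlocks_cons_of_lt h, reverseBlocks_cons_of_lt h, ih]
  | block a f g h hf hg ih =>
    rw [reverseBlocks_block h hf hg, reverseBlocks_block h (by simpa using hf)
      (by rwa [head?_reverseBlocks]), ih, List.reverse_reverse]

theorem reverseBlocks_perm (p : ℕ+) (w : List ℕ+) : (reverseBlocks p w).Perm w := by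
  induction w using block_induction p with
  | nil => rw [reverseBlocks_nil]
  | low a w h ih => rw [reverseBlocks_cons_of_lt h]; exact ih.cons a
  | block a f g h hf hg ih =>
    rw [reverseBlocks_block h hf hg]
    exact ((List.reverse_perm f).append ih).cons a

theorem genFactorLE_cons_of_lt {p a : ℕ+} (h : a < p) (u w : List ℕ+) :
    GenFactorLE (p :: u) (a :: w) ↔ GenFactorLE (p :: u) w := by
  simp [genFactorLE_cons, prefixLE_cons_cons, not_le.2 h]

/-- No window can use a letter below `p`, so none straddles `f` and `g`. Within the block `p` is
dominated for free; `a` precedes `f`, so every occurrence of `[x, y]` in `f` has a letter before it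
to serve for `p`. -/
theorem genFactorLE_block {p x y a : ℕ+} (hx : p ≤ x) (hy : p ≤ y) (ha : p ≤ a)
    {f g : List ℕ+} (hf : ∀ z ∈ f, p ≤ z) (hg : ∀ z ∈ g.head?, z < p) :
    GenFactorLE [p, x, y] (a :: (f ++ g)) ↔ GenFactorLE [x, y] f ∨ GenFactorLE [p, x, y] g := by
  have hlow : ∀ q : ℕ+, p ≤ q → ∀ u, ¬ PrefixLE (q :: u) g := by
    intro q hq u h
    cases g with
    | nil => exact not_prefixLE_cons_nil _ _ h
    | cons b g =>
      rw [prefixLE_cons_cons] at h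
      exact absurd (hg b (by simp)) (not_lt.2 (hq.trans h.1))
  induction f generalizing a with
  | nil =>
    simp [genFactorLE_cons, prefixLE_cons_cons, hlow x hx, not_genFactorLE_cons_nil]
  | cons b f ih =>
    have hb : GenFactorLE [p, x, y] (b :: (f ++ g)) ↔
        GenFactorLE [x, y] f ∨ GenFactorLE [p, x, y] g :=
      ih (a := b) (hf b List.mem_cons_self) fun z hz => hf z (List.mem_cons_of_mem b hz)
    rw [genFactorLE_cons, List.cons_append, hb, genFactorLE_cons [x, y],
      prefixLE_cons_cons, prefixLE_cons_cons, prefixLE_cons_cons]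
    -- When `f` is empty, `y` would have to fall on the head of `g`, which is below `p`.
    have : PrefixLE [y] (f ++ g) ↔ PrefixLE [y] f := by
      cases f with
      | nil => simp [hlow y hy, not_prefixLE_cons_nil]
      | cons c f => simp [prefixLE_cons_cons, prefixLE_nil]
    simp [this, ha, or_assoc]

theorem genFactorLE_reverseBlocks {p x y : ℕ+} (hx : p ≤ x) (hy : p ≤ y) (w : List ℕ+) :
    GenFactorLE [p, y, x] (reverseBlocks p w) ↔ GenFactorLE [p, x, y] w := by
  induction w using block_induction p with
  | nil => simp [reverseBlocks_nil, not_genFactorLE_cons_nil]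
  | low a w h ih =>
    rw [reverseBlocks_cons_of_lt h, genFactorLE_cons_of_lt h, genFactorLE_cons_of_lt h, ih]
  | block a f g h hf hg ih =>
    rw [reverseBlocks_block h hf hg, genFactorLE_block hy hx h (by simpa using hf)
      (by rwa [head?_reverseBlocks]), genFactorLE_block hx hy h hf hg, ih,
      ← genFactorLE_reverse_iff (u := [x, y])]
    rfl

end BlockReversal

/-! ### The two moves as Wilf equivalences. -/

section WilfEquivalences

theorem wt_eq_of_perm {w w' : List ℕ+} (h : w.Perm w') : wt w = wt w' := by
  rw [wt, wt, h.length_eq, letterSum, letterSum, (h.map _).sum_eq]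

/-- A rearrangement of letters in each word that is an involution and carries the embedding
words of `u` to those of `v` witnesses a Wilf equivalence. -/
theorem embeddingGenFun_eq_of_involutive {u v : List ℕ+} {φ : List ℕ+ → List ℕ+}
    (hφ : Function.Involutive φ) (hperm : ∀ w, (φ w).Perm w)
    (h : ∀ w, GenFactorLE v (φ w) ↔ GenFactorLE u w) :
    embeddingGenFun u = embeddingGenFun v := by
  funext m
  refine finsum_mem_eq_of_bijOn φ ⟨fun w hw => (h w).2 hw, hφ.injective.injOn, ?_⟩ ?_
  · intro w hw
    exact ⟨φ w, (h (φ w)).1 ((hφ w).symm ▸ hw), hφ w⟩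
  · intro w _
    rw [wt_eq_of_perm (hperm w)]

theorem embeddingGenFun_reverse (u : List ℕ+) :
    embeddingGenFun u.reverse = embeddingGenFun u :=
  (embeddingGenFun_eq_of_involutive List.reverse_involutive List.reverse_perm
    fun _ => genFactorLE_reverse_iff).symm

theorem embeddingGenFun_swap {p x y : ℕ+} (hx : p ≤ x) (hy : p ≤ y) :
    embeddingGenFun [p, x, y] = embeddingGenFun [p, y, x] :=
  embeddingGenFun_eq_of_involutive (reverseBlocks_reverseBlocks p) (reverseBlocks_perm p)
    (genFactorLE_reverseBlocks hx hy)

end WilfEquivalences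

/-! ### Counting embedding words of length 3, 4 and 5. -/

section Counting

open Finset PowerSeries

/-- The word of positive integers whose letters exceed the entries of `w` by one. -/
def tupleWord {n : ℕ} (w : Fin n → ℕ) : List ℕ+ :=
  List.ofFn fun i => Nat.succPNat (w i)

theorem length_tupleWord {n : ℕ} (w : Fin n → ℕ) : (tupleWord w).length = n := by
  simp [tupleWord]

theorem letterSum_tupleWord {n : ℕ} (w : Fin n → ℕ) :
    letterSum (tupleWord w) = ∑ i, w i + n := by
  simp [letterSum, tupleWord, List.sum_ofFn, Function.comp_def, Finset.sum_add_distrib]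

theorem tupleWord_injective (n : ℕ) : Function.Injective (tupleWord (n := n)) := by
  intro w w' h
  funext i
  exact Nat.succPNat_injective (congrFun (List.ofFn_injective h) i)

theorem exists_tupleWord_eq (w : List ℕ+) : ∃ w' : Fin w.length → ℕ, tupleWord w' = w :=
  ⟨fun i => (w.get i).natPred, by simp [tupleWord]⟩

open Classical in
/-- The generating function, by sum of the entries, of the `n`-tuples with property `W`. -/
noncomputable def tupleSeries {n : ℕ} (W : (Fin n → ℕ) → Prop) : ℤ⟦X⟧ :=
  PowerSeries.mk fun N => ∑ w ∈ Finset.Nat.antidiagonalTuple n N, if W w then 1 else 0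

theorem coeff_single_wt (n N : ℕ) (w : List ℕ+) :
    MvPowerSeries.coeff (Finsupp.single 0 n + Finsupp.single 1 N : Fin 2 →₀ ℕ) (wt w) =
      if w.length = n ∧ letterSum w = N then 1 else 0 := by
  rw [wt_eq_monomial, MvPowerSeries.coeff_monomial]
  congr 1
  rw [Finsupp.ext_iff]
  simp [Fin.forall_fin_two, eq_comm]

/-- The exponent `N + n` arises because each of the `n` letters exceeds its entry by one. -/
theorem coeff_tupleSeries_genFactorLE (u : List ℕ+) (n N : ℕ) :
    PowerSeries.coeff N (tupleSeries fun w : Fin n → ℕ => GenFactorLE u (tupleWord w)) =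
      embeddingGenFun u (Finsupp.single 0 n + Finsupp.single 1 (N + n)) := by
  classical
  rw [embeddingGenFun, finsum_mem_eq_sum_of_inter_support_eq (t :=
    ((Finset.Nat.antidiagonalTuple n N).filter fun w => GenFactorLE u (tupleWord w)).image
      tupleWord)]
  · rw [Finset.sum_image (tupleWord_injective n).injOn, Finset.sum_filter, tupleSeries,
      PowerSeries.coeff_mk]
    refine Finset.sum_congr rfl fun w hw => ?_
    rw [Finset.Nat.mem_antidiagonalTuple] at hw
    rw [coeff_single_wt, if_pos (⟨length_tupleWord w, by rw [letterSum_tupleWord, hw]⟩ :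
      _ ∧ letterSum (tupleWord w) = N + n)]
  · ext w
    simp only [Set.mem_inter_iff, Function.mem_support, coeff_single_wt, Finset.coe_image,
      Set.mem_image, Finset.mem_coe, Finset.mem_filter, Finset.Nat.mem_antidiagonalTuple]
    refine and_congr_left fun h => ⟨fun hw => ?_, ?_⟩
    · have h : w.length = n ∧ letterSum w = N + n := by
        by_contra h'
        exact h (if_neg h')
      obtain ⟨rfl, h⟩ := h
      obtain ⟨w', hw'⟩ := exists_tupleWord_eq w
      refine ⟨w', ⟨?_, hw'.symm ▸ hw⟩, hw'⟩
      have := letterSum_tupleWord w'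
      rw [hw', h] at this
      omega
    · rintro ⟨w', h', rfl⟩
      exact h'.2

theorem tupleSeries_genFactorLE_eq {u v : List ℕ+} (h : embeddingGenFun u = embeddingGenFun v)
    (n : ℕ) :
    (tupleSeries fun w : Fin n → ℕ => GenFactorLE u (tupleWord w)) =
      tupleSeries fun w : Fin n → ℕ => GenFactorLE v (tupleWord w) := by
  ext N
  rw [coeff_tupleSeries_genFactorLE, coeff_tupleSeries_genFactorLE, h]

theorem tupleSeries_or {n : ℕ} (V W : (Fin n → ℕ) → Prop) :
    tupleSeries (fun w => V w ∨ W w) =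
      tupleSeries V + tupleSeries W - tupleSeries fun w => V w ∧ W w := by
  ext N
  simp only [tupleSeries, map_add, map_sub, PowerSeries.coeff_mk, ← Finset.sum_add_distrib,
    ← Finset.sum_sub_distrib]
  refine Finset.sum_congr rfl fun w _ => ?_
  by_cases h1 : V w <;> by_cases h2 : W w <;> simp [h1, h2]

/-- Subtracting `m` maps the tuples above `m` bijectively onto all tuples. The common factor is
nonzero and is cancelled later. -/
theorem tupleSeries_le {n : ℕ} (m : Fin n → ℕ) :
    tupleSeries (fun w => m ≤ w) = X ^ (∑ i, m i) * tupleSeries fun _ : Fin n → ℕ => True := by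
  classical
  ext N
  rw [PowerSeries.coeff_X_pow_mul']
  simp only [tupleSeries, PowerSeries.coeff_mk, if_true]
  split_ifs with h
  · rw [← Finset.sum_filter]
    refine Finset.sum_bij' (fun w _ => w - m) (fun w _ => w + m) ?_ ?_ ?_ ?_ ?_
    · intro w hw
      rw [Finset.mem_filter, Finset.Nat.mem_antidiagonalTuple] at hw
      rw [Finset.Nat.mem_antidiagonalTuple, ← hw.1]
      exact Finset.sum_tsub_distrib _ fun i _ => hw.2 i
    · intro w hw
      rw [Finset.Nat.mem_antidiagonalTuple] at hw
      rw [Finset.mem_filter, Finset.Nat.mem_antidiagonalTuple]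
      refine ⟨?_, le_add_self⟩
      simp only [Pi.add_apply, Finset.sum_add_distrib, hw]
      omega
    · intro w hw
      exact tsub_add_cancel_of_le (Finset.mem_filter.1 hw).2
    · intro w _
      exact add_tsub_cancel_right w m
    · intros; rfl
  · refine Finset.sum_eq_zero fun w hw => if_neg fun hm => h ?_
    rw [Finset.Nat.mem_antidiagonalTuple] at hw
    rw [← hw]
    exact Finset.sum_le_sum fun i _ => hm i

theorem tupleSeries_true_ne_zero (n : ℕ) : tupleSeries (fun _ : Fin n → ℕ => True) ≠ 0 := by
  intro h
  have := congrArg (PowerSeries.coeff 0) h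
  simp [tupleSeries, Finset.Nat.antidiagonalTuple_zero_right] at this

theorem le_succPNat_iff (a : ℕ+) (k : ℕ) : a ≤ Nat.succPNat k ↔ a.natPred ≤ k := by
  rw [← PNat.coe_le_coe, Nat.succPNat_coe, ← PNat.natPred_add_one a, Nat.succ_le_succ_iff]

theorem tupleSeries_three (a b c : ℕ+) :
    (tupleSeries fun w : Fin 3 → ℕ => GenFactorLE [a, b, c] (tupleWord w)) =
      X ^ (a.natPred + b.natPred + c.natPred) * tupleSeries fun _ : Fin 3 → ℕ => True := by
  have h : (fun w : Fin 3 → ℕ => GenFactorLE [a, b, c] (tupleWord w)) =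
      fun w => ![a.natPred, b.natPred, c.natPred] ≤ w := by
    funext w
    simp [tupleWord, List.ofFn_succ, genFactorLE_cons, prefixLE_cons_cons, prefixLE_nil,
      not_prefixLE_cons_nil, not_genFactorLE_cons_nil, le_succPNat_iff, Pi.le_def,
      Fin.forall_fin_succ]
  rw [h, tupleSeries_le]
  simp [Fin.sum_univ_succ, add_assoc]

theorem tupleSeries_four (a b c : ℕ+) :
    (tupleSeries fun w : Fin 4 → ℕ => GenFactorLE [a, b, c] (tupleWord w)) =
      (2 * X ^ (a.natPred + b.natPred + c.natPred) -
        X ^ (a.natPred + max a.natPred b.natPred + max b.natPred c.natPred + c.natPred)) *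
      tupleSeries fun _ : Fin 4 → ℕ => True := by
  -- One bound for each position of the window; an entry 0 imposes nothing.
  have h : (fun w : Fin 4 → ℕ => GenFactorLE [a, b, c] (tupleWord w)) =
      fun w => ![a.natPred, b.natPred, c.natPred, 0] ≤ w ∨
        ![0, a.natPred, b.natPred, c.natPred] ≤ w := by
    funext w
    simp [tupleWord, List.ofFn_succ, genFactorLE_cons, prefixLE_cons_cons, prefixLE_nil,
      not_prefixLE_cons_nil, not_genFactorLE_cons_nil, le_succPNat_iff, Pi.le_def,
      Fin.forall_fin_succ]
  rw [h, tupleSeries_or]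
  simp only [← sup_le_iff]
  rw [tupleSeries_le, tupleSeries_le, tupleSeries_le]
  simp only [Fin.sum_univ_four, Pi.sup_apply]
  simp [add_assoc, max_comm]
  ring

/-- Inclusion-exclusion over three windows: the two adjacent pairs contribute equally, the outer
pair shares only the third position, and the last term is the triple overlap. -/
theorem tupleSeries_five (a b c : ℕ+) :
    (tupleSeries fun w : Fin 5 → ℕ => GenFactorLE [a, b, c] (tupleWord w)) =
      (3 * X ^ (a.natPred + b.natPred + c.natPred) -
        2 * X ^ (a.natPred + max a.natPred b.natPred + max b.natPred c.natPred + c.natPred) -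
        X ^ (a.natPred + b.natPred + max a.natPred c.natPred + b.natPred + c.natPred) +
        X ^ (a.natPred + max a.natPred b.natPred + max a.natPred (max b.natPred c.natPred) +
          max b.natPred c.natPred + c.natPred)) *
      tupleSeries fun _ : Fin 5 → ℕ => True := by
  have h : (fun w : Fin 5 → ℕ => GenFactorLE [a, b, c] (tupleWord w)) =
      fun w => (![a.natPred, b.natPred, c.natPred, 0, 0] ≤ w ∨
        ![0, a.natPred, b.natPred, c.natPred, 0] ≤ w) ∨
        ![0, 0, a.natPred, b.natPred, c.natPred] ≤ w := by
    funext w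
    simp [tupleWord, List.ofFn_succ, genFactorLE_cons, prefixLE_cons_cons, prefixLE_nil,
      not_prefixLE_cons_nil, not_genFactorLE_cons_nil, le_succPNat_iff, Pi.le_def,
      Fin.forall_fin_succ, or_assoc]
  rw [h, tupleSeries_or, tupleSeries_or]
  simp only [or_and_right]
  rw [tupleSeries_or]
  simp only [← sup_le_iff]
  simp only [tupleSeries_le]
  simp only [Fin.sum_univ_five, Pi.sup_apply]
  simp [add_assoc, max_comm, max_left_comm]
  ring

end Counting

/-! ### Separating the classes and completing the list. -/

section Classification

/-- An equality of differences of powers of `X` pins down the exponents unless the differences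
vanish. -/
theorem exponents_of_X_pow_sub_eq {k l k' l' : ℕ}
    (h : (PowerSeries.X ^ k - PowerSeries.X ^ l : PowerSeries ℤ) =
      PowerSeries.X ^ k' - PowerSeries.X ^ l') :
    (k = k' ∧ l = l') ∨ (k = l ∧ k' = l') := by
  have hk := congrArg (PowerSeries.coeff k) h
  have hl := congrArg (PowerSeries.coeff l) h
  have hk' := congrArg (PowerSeries.coeff k') h
  simp only [map_sub, PowerSeries.coeff_X_pow] at hk hl hk'
  split_ifs at hk <;> split_ifs at hl <;> split_ifs at hk' <;> omega

/-- Since `max a b ≥ b`, `max b c ≥ b` and `max a (max b c) ≥ max a c`, equality of the sums forces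
equality in each. -/
theorem max_eq_of_overlap_sums_eq {a b c : ℕ}
    (h : a + max a b + max a (max b c) + max b c + c = a + b + max a c + b + c) :
    max a b = b ∧ max b c = b ∧ max a c = b ∧ max a (max b c) = b := by
  rcases le_total a b with h1 | h1 <;> rcases le_total b c with h2 | h2 <;>
    rcases le_total a c with h3 | h3 <;> refine ⟨?_, ?_, ?_, ?_⟩ <;> omega

/-- Statistics of a word of length three, in terms of its letters minus one, that its generating
function determines. -/
theorem overlap_sums_of_embeddingGenFun_eq {a b c d e f : ℕ+}
    (h : embeddingGenFun [a, b, c] = embeddingGenFun [d, e, f]) :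
    a.natPred + b.natPred + c.natPred = d.natPred + e.natPred + f.natPred ∧
    max a.natPred (max b.natPred c.natPred) = max d.natPred (max e.natPred f.natPred) ∧
    a.natPred + max a.natPred b.natPred + max b.natPred c.natPred + c.natPred =
      d.natPred + max d.natPred e.natPred + max e.natPred f.natPred + f.natPred ∧
    b.natPred + max a.natPred c.natPred = e.natPred + max d.natPred f.natPred := by
  have h3 := tupleSeries_genFactorLE_eq h 3
  have h4 := tupleSeries_genFactorLE_eq h 4
  have h5 := tupleSeries_genFactorLE_eq h 5
  rw [tupleSeries_three, tupleSeries_three] at h3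
  rw [tupleSeries_four, tupleSeries_four] at h4
  rw [tupleSeries_five, tupleSeries_five] at h5
  replace h3 := mul_right_cancel₀ (tupleSeries_true_ne_zero 3) h3
  replace h4 := mul_right_cancel₀ (tupleSeries_true_ne_zero 4) h4
  replace h5 := mul_right_cancel₀ (tupleSeries_true_ne_zero 5) h5
  rw [h3, sub_right_inj] at h4
  rw [h3, h4] at h5
  have cancel : ∀ p q k l k' l' : PowerSeries ℤ,
      p - q - l + k = p - q - l' + k' → k - l = k' - l' := by
    intro p q k l k' l' h
    linear_combination h
  have h6 := exponents_of_X_pow_sub_eq (cancel _ _ _ _ _ _ h5)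
  have inj : ∀ k l : ℕ, (PowerSeries.X ^ k : PowerSeries ℤ) = PowerSeries.X ^ l → k = l := by
    intro k l hkl
    have := congrArg (PowerSeries.coeff k) hkl
    simpa [PowerSeries.coeff_X_pow] using this
  replace h3 := inj _ _ h3
  replace h4 := inj _ _ h4
  -- Either the exponents agree separately, or on both sides the triple and outer overlaps cancel.
  -- In the latter case each middle letter equals the maximum, and `h3` with `h4` identifies the
  -- two.
  rcases h6 with ⟨h6, h7⟩ | ⟨h6, h7⟩
  · exact ⟨h3, by linarith, h4, by linarith⟩
  · obtain ⟨h8, h9, h10, h11⟩ := max_eq_of_overlap_sums_eq h6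
    obtain ⟨h12, h13, h14, h15⟩ := max_eq_of_overlap_sums_eq h7
    rw [h8, h9, h12, h13] at h4
    rw [h11, h8, h9, h10, h15, h12, h13, h14]
    omega

theorem wilfEquivThree_iff {a b c d e f : ℕ+} :
    wilfEquivThree (wordThree a b c) (wordThree d e f) ↔
      embeddingGenFun [a, b, c] = embeddingGenFun [d, e, f] :=
  Iff.rfl

theorem wordThree_inj {a b c d e f : ℕ+} :
    wordThree a b c = wordThree d e f ↔
      a.natPred = d.natPred ∧ b.natPred = e.natPred ∧ c.natPred = f.natPred := by
  have h : wordThree a b c = wordThree d e f ↔ [a, b, c] = [d, e, f] := Subtype.ext_iff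
  simp [h, PNat.natPred_inj]

theorem exists_eq_wordThree (x : List.Vector ℕ+ 3) : ∃ a b c, x = wordThree a b c := by
  obtain ⟨w, hw⟩ := x
  obtain ⟨a, b, c, rfl⟩ := List.length_eq_three.1 hw
  exact ⟨a, b, c, rfl⟩

theorem wilfEquivThree_reverse (a b c : ℕ+) :
    wilfEquivThree (wordThree c b a) (wordThree a b c) :=
  wilfEquivThree_iff.2 (embeddingGenFun_reverse [a, b, c])

theorem wilfEquivThree_swap {a b c : ℕ+} (hb : a ≤ b) (hc : a ≤ c) :
    wilfEquivThree (wordThree a c b) (wordThree a b c) :=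
  wilfEquivThree_iff.2 (embeddingGenFun_swap hc hb)

theorem wilfClass_const (a : ℕ+) :
    {x | wilfEquivThree x (wordThree a a a)} = {wordThree a a a} := by
  ext x
  obtain ⟨d, e, f, rfl⟩ := exists_eq_wordThree x
  simp only [Set.mem_ofPred_eq, Set.mem_singleton_iff]
  constructor
  · intro h
    have h := overlap_sums_of_embeddingGenFun_eq (wilfEquivThree_iff.1 h)
    simp only [wordThree_inj]
    -- Fixing the order of `d`, `e`, `f` resolves every maximum, leaving linear arithmetic.
    rcases le_total d.natPred e.natPred with h1 | h1 <;>
      rcases le_total e.natPred f.natPred with h2 | h2 <;>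
      rcases le_total d.natPred f.natPred with h3 | h3 <;>
      simp only [max_eq_left, max_eq_right, max_self, h1, h2, h3] at h <;> omega
  · intro h
    rw [h]

theorem wilfClass_two_small {a b : ℕ+} (hab : a < b) :
    {x | wilfEquivThree x (wordThree a a b)} =
      {wordThree a a b, wordThree a b a, wordThree b a a} := by
  ext x
  obtain ⟨d, e, f, rfl⟩ := exists_eq_wordThree x
  simp only [Set.mem_ofPred_eq, Set.mem_insert_iff, Set.mem_singleton_iff]
  constructor
  · intro h
    have h := overlap_sums_of_embeddingGenFun_eq (wilfEquivThree_iff.1 h)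
    rw [← PNat.natPred_lt_natPred] at hab
    simp only [wordThree_inj]
    rcases le_total d.natPred e.natPred with h1 | h1 <;>
      rcases le_total e.natPred f.natPred with h2 | h2 <;>
      rcases le_total d.natPred f.natPred with h3 | h3 <;>
      simp only [max_eq_left, max_eq_right, max_self, h1, h2, h3, hab.le] at h <;> omega
  · rintro (h | h | h) <;> rw [h]
    · exact wilfEquivThree_swap le_rfl hab.le
    · exact wilfEquivThree_reverse _ _ _

theorem wilfClass_two_large {a b : ℕ+} (hba : b < a) :
    {x | wilfEquivThree x (wordThree a a b)} = {wordThree a a b, wordThree b a a} := by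
  ext x
  obtain ⟨d, e, f, rfl⟩ := exists_eq_wordThree x
  simp only [Set.mem_ofPred_eq, Set.mem_insert_iff, Set.mem_singleton_iff]
  constructor
  · intro h
    have h := overlap_sums_of_embeddingGenFun_eq (wilfEquivThree_iff.1 h)
    rw [← PNat.natPred_lt_natPred] at hba
    simp only [wordThree_inj]
    rcases le_total d.natPred e.natPred with h1 | h1 <;>
      rcases le_total e.natPred f.natPred with h2 | h2 <;>
      rcases le_total d.natPred f.natPred with h3 | h3 <;>
      simp only [max_eq_left, max_eq_right, max_self, h1, h2, h3, hba.le] at h <;> omega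
  · rintro (h | h) <;> rw [h]
    exact wilfEquivThree_reverse _ _ _

theorem wilfClass_two_large_separated {a b : ℕ+} (hba : b < a) :
    {x | wilfEquivThree x (wordThree a b a)} = {wordThree a b a} := by
  ext x
  obtain ⟨d, e, f, rfl⟩ := exists_eq_wordThree x
  simp only [Set.mem_ofPred_eq, Set.mem_singleton_iff]
  constructor
  · intro h
    have h := overlap_sums_of_embeddingGenFun_eq (wilfEquivThree_iff.1 h)
    rw [← PNat.natPred_lt_natPred] at hba
    simp only [wordThree_inj]
    rcases le_total d.natPred e.natPred with h1 | h1 <;>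
      rcases le_total e.natPred f.natPred with h2 | h2 <;>
      rcases le_total d.natPred f.natPred with h3 | h3 <;>
      simp only [max_eq_left, max_eq_right, max_self, h1, h2, h3, hba.le] at h <;> omega
  · intro h
    rw [h]

theorem wilfClass_min_in_middle {a b c : ℕ+} (hab : a < b) (hbc : b < c) :
    {x | wilfEquivThree x (wordThree b a c)} = {wordThree b a c, wordThree c a b} := by
  ext x
  obtain ⟨d, e, f, rfl⟩ := exists_eq_wordThree x
  simp only [Set.mem_ofPred_eq, Set.mem_insert_iff, Set.mem_singleton_iff]
  constructor
  · intro h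
    have h := overlap_sums_of_embeddingGenFun_eq (wilfEquivThree_iff.1 h)
    rw [← PNat.natPred_lt_natPred] at hab hbc
    simp only [wordThree_inj]
    rcases le_total d.natPred e.natPred with h1 | h1 <;>
      rcases le_total e.natPred f.natPred with h2 | h2 <;>
      rcases le_total d.natPred f.natPred with h3 | h3 <;>
      simp only [max_eq_left, max_eq_right, h1, h2, h3, hab.le, hbc.le, (hab.trans hbc).le] at h <;> omega
  · rintro (h | h) <;> rw [h]
    exact wilfEquivThree_reverse _ _ _

theorem wilfClass_min_at_end {a b c : ℕ+} (hab : a < b) (hbc : b < c) :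
    {x | wilfEquivThree x (wordThree a b c)} =
      {wordThree a b c, wordThree a c b, wordThree c b a, wordThree b c a} := by
  have hac := hab.trans hbc
  have hswap := wilfEquivThree_swap hab.le hac.le
  ext x
  obtain ⟨d, e, f, rfl⟩ := exists_eq_wordThree x
  simp only [Set.mem_ofPred_eq, Set.mem_insert_iff, Set.mem_singleton_iff]
  constructor
  · intro h
    have h := overlap_sums_of_embeddingGenFun_eq (wilfEquivThree_iff.1 h)
    rw [← PNat.natPred_lt_natPred] at hab hbc
    simp only [wordThree_inj]
    rcases le_total d.natPred e.natPred with h1 | h1 <;>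
      rcases le_total e.natPred f.natPred with h2 | h2 <;>
      rcases le_total d.natPred f.natPred with h3 | h3 <;>
      simp only [max_eq_left, max_eq_right, h1, h2, h3, hab.le, hbc.le, (hab.trans hbc).le] at h <;> omega
  · rintro (h | h | h | h) <;> rw [h]
    · exact hswap
    · exact wilfEquivThree_reverse _ _ _
    · exact wilfEquivThree.trans (wilfEquivThree_reverse _ _ _) hswap

/-- The list of classes in the classification of words of length three. -/
def IsListedClass (C : Set (List.Vector ℕ+ 3)) : Prop :=
  (∃ a : ℕ+, C = {wordThree a a a}) ∨
  (∃ a b : ℕ+, a < b ∧ C = {wordThree a a b, wordThree a b a, wordThree b a a}) ∨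
  (∃ a b : ℕ+, b < a ∧
    (C = {wordThree a a b, wordThree b a a} ∨ C = {wordThree a b a})) ∨
  (∃ a b c : ℕ+, a < b ∧ b < c ∧
    (C = {wordThree b a c, wordThree c a b} ∨
      C = {wordThree a b c, wordThree a c b, wordThree c b a, wordThree b c a}))

theorem IsListedClass.exists_eq_wilfClass {C : Set (List.Vector ℕ+ 3)} (h : IsListedClass C) :
    ∃ y, C = {x | wilfEquivThree x y} := by
  rcases h with ⟨a, rfl⟩ | ⟨a, b, hab, rfl⟩ | ⟨a, b, hba, rfl | rfl⟩ |
    ⟨a, b, c, hab, hbc, rfl | rfl⟩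
  · exact ⟨_, (wilfClass_const a).symm⟩
  · exact ⟨_, (wilfClass_two_small hab).symm⟩
  · exact ⟨_, (wilfClass_two_large hba).symm⟩
  · exact ⟨_, (wilfClass_two_large_separated hba).symm⟩
  · exact ⟨_, (wilfClass_min_in_middle hab hbc).symm⟩
  · exact ⟨_, (wilfClass_min_at_end hab hbc).symm⟩

theorem exists_isListedClass_mem (x : List.Vector ℕ+ 3) : ∃ C, IsListedClass C ∧ x ∈ C := by
  obtain ⟨a, b, c, rfl⟩ := exists_eq_wordThree x
  have const (a : ℕ+) := (Or.inl ⟨a, rfl⟩ : IsListedClass {wordThree a a a})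
  have small {a b : ℕ+} (h : a < b) := (Or.inr (Or.inl ⟨a, b, h, rfl⟩) :
    IsListedClass {wordThree a a b, wordThree a b a, wordThree b a a})
  have large {a b : ℕ+} (h : b < a) := (Or.inr (Or.inr (Or.inl ⟨a, b, h, Or.inl rfl⟩)) :
    IsListedClass {wordThree a a b, wordThree b a a})
  have sep {a b : ℕ+} (h : b < a) := (Or.inr (Or.inr (Or.inl ⟨a, b, h, Or.inr rfl⟩)) :
    IsListedClass {wordThree a b a})
  have middle {a b c : ℕ+} (h : a < b) (h' : b < c) :=
    (Or.inr (Or.inr (Or.inr ⟨a, b, c, h, h', Or.inl rfl⟩)) :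
      IsListedClass {wordThree b a c, wordThree c a b})
  have ends {a b c : ℕ+} (h : a < b) (h' : b < c) :=
    (Or.inr (Or.inr (Or.inr ⟨a, b, c, h, h', Or.inr rfl⟩)) :
      IsListedClass {wordThree a b c, wordThree a c b, wordThree c b a, wordThree b c a})
  rcases lt_trichotomy a b with hab | rfl | hab
  · rcases lt_trichotomy b c with hbc | rfl | hbc
    · exact ⟨_, ends hab hbc, by simp⟩
    · exact ⟨_, large hab, by simp⟩
    · rcases lt_trichotomy a c with hac | rfl | hac
      · exact ⟨_, ends hac hbc, by simp⟩
      · exact ⟨_, small hab, by simp⟩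
      · exact ⟨_, ends hac hab, by simp⟩
  · rcases lt_trichotomy a c with hac | rfl | hac
    · exact ⟨_, small hac, by simp⟩
    · exact ⟨_, const a, by simp⟩
    · exact ⟨_, large hac, by simp⟩
  · rcases lt_trichotomy b c with hbc | rfl | hbc
    · rcases lt_trichotomy a c with hac | rfl | hac
      · exact ⟨_, middle hab hac, by simp⟩
      · exact ⟨_, sep hab, by simp⟩
      · exact ⟨_, middle hbc hac, by simp⟩
    · exact ⟨_, small hab, by simp⟩
    · exact ⟨_, ends hbc hab, by simp⟩

end Classification

theorem theorem5 :
    Setoid.classes wilfEquivThree =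
      {C : Set (List.Vector ℕ+ 3) |
        (∃ a : ℕ+, C = {wordThree a a a}) ∨
        (∃ a b : ℕ+, a < b ∧ C = {wordThree a a b, wordThree a b a, wordThree b a a}) ∨
        (∃ a b : ℕ+, b < a ∧
          (C = {wordThree a a b, wordThree b a a} ∨ C = {wordThree a b a})) ∨
        (∃ a b c : ℕ+, a < b ∧ b < c ∧
          (C = {wordThree b a c, wordThree c a b} ∨
            C = {wordThree a b c, wordThree a c b, wordThree c b a, wordThree b c a}))} := by
  ext C
  change C ∈ wilfEquivThree.classes ↔ IsListedClass C
  refine ⟨?_, IsListedClass.exists_eq_wilfClass⟩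
  rintro ⟨y, rfl⟩
  -- The listed set containing `y` is itself a Wilf class, hence it is the class of `y`.
  obtain ⟨C, hC, hy⟩ := exists_isListedClass_mem y
  obtain ⟨z, rfl⟩ := hC.exists_eq_wilfClass
  convert hC using 1
  ext x
  exact ⟨fun h => wilfEquivThree.trans h hy,
    fun h => wilfEquivThree.trans h (wilfEquivThree.symm hy)⟩
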